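/- Identify $M_k\otimes M_k$ (with $M_k=M_k(\mathbb{C})$) with $M_{k^2}$ via the Kronecker product, and equip $M_k$ with the inner product $\langle C,D\rangle=\operatorname{tr}(CD^*)$. A \emph{Hermitian Schmidt decomposition} of $A\in M_k\otimes M_k$ is an expression $A=\sum_{i=1}^n\lambda_i\,\gamma_i\otimes\delta_i$ in which $\lambda_i>0$ are real numbers and $\gamma_1,\dots,\gamma_n\in M_k$ and $\delta_1,\dots,\delta_n\in M_k$ are two orthonormal families of Hermitian matrices (for $A=0$ the empty sum, $n=0$, is allowed). A positive semidefinite Hermitian matrix $A\in M_k\otimes M_k$ is called \emph{SPC} (symmetric with positive coefficients) if it has a Hermitian Schmidt decomposition of the form $A=\sum_{i=1}^n\lambda_i\,\gamma_i\otimes\gamma_i$. \textbf{Theorem (Split decomposition for SPC matrices).} Let $A\in M_k\otimes M_k$ be an SPC matrix, and let $A=\sum_{i=1}^n\lambda_i\,\gamma_i\otimes\gamma_i$ be a Hermitian Schmidt decomposition of $A$ such that, for some $1\le s\le n$, $\lambda_1=\dots=\lambda_s>\lambda_{s+1}\ge\dots\ge\lambda_n>0$ (if $s=n$ this means $\lambda_1=\dots=\lambda_n>0$).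 Let $D=\sum_{i=1}^s\gamma_i\otimes\gamma_i$. a) There exists a Hermitian Schmidt decomposition $D=\sum_{i=1}^s\gamma_i'\otimes\gamma_i'$ such that every $\gamma_i'$ is positive semidefinite, and it is unique up to the order of the terms. b) Let $\gamma_1',\dots,\gamma_s'$ be as in a). Then the sum $\Im(\gamma_1')+\dots+\Im(\gamma_s')\subset\mathbb{C}^k$ of the images is direct. Let $V_i\in M_k$ be the Hermitian (orthogonal) projection onto $\Im(\gamma_i')$ for $1\le i\le s$, and let $V_{s+1}\in M_k$ be the Hermitian projection onto $(\Im(\gamma_1')\oplus\dots\oplus\Im(\gamma_s'))^{\perp}$. Then $$A=\sum_{i=1}^{s+1}(V_i\otimes V_i)\,A\,(V_i\otimes V_i),$$ and each matrix $(V_i\otimes V_i)\,A\,(V_i\otimes V_i)$, $1\le i\le s+1$, is again SPC. -/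

import Mathlib

open scoped ComplexOrder Kronecker

noncomputable section

namespace SplitDecomposition

/-- A finite family of matrices is orthonormal for the inner product `⟨C, D⟩ = tr (C D*)`. -/
def TraceOrthonormal {k n : ℕ} (γ : Fin n → Matrix (Fin k) (Fin k) ℂ) : Prop :=
  ∀ i j, Matrix.trace (γ i * (γ j).conjTranspose) = if i = j then 1 else 0

/-- `A = ∑ i, lam i • γ i ⊗ δ i` is a Schmidt decomposition of `A ∈ M_k ⊗ M_m`, where `M_k ⊗ M_m`
is identified with `M_{km}` through the Kronecker product. The empty decomposition (of `A = 0`)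
is allowed. -/
structure IsSchmidtDecomposition {k m n : ℕ}
    (A : Matrix (Fin k × Fin m) (Fin k × Fin m) ℂ) (lam : Fin n → ℝ)
    (γ : Fin n → Matrix (Fin k) (Fin k) ℂ) (δ : Fin n → Matrix (Fin m) (Fin m) ℂ) : Prop where
  pos : ∀ i, 0 < lam i
  orthonormal_left : TraceOrthonormal γ
  orthonormal_right : TraceOrthonormal δ
  eq_sum : A = ∑ i, (lam i : ℂ) • (γ i ⊗ₖ δ i)

/-- A Schmidt decomposition all of whose matrices are Hermitian. -/
structure IsHermitianSchmidtDecomposition {k m n : ℕ}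
    (A : Matrix (Fin k × Fin m) (Fin k × Fin m) ℂ) (lam : Fin n → ℝ)
    (γ : Fin n → Matrix (Fin k) (Fin k) ℂ) (δ : Fin n → Matrix (Fin m) (Fin m) ℂ) : Prop
    extends IsSchmidtDecomposition A lam γ δ where
  isHermitian_left : ∀ i, (γ i).IsHermitian
  isHermitian_right : ∀ i, (δ i).IsHermitian

/-- Symmetric with positive coefficients: a positive semidefinite Hermitian matrix that has a
Hermitian Schmidt decomposition of the form `∑ i, lam i • γ i ⊗ γ i`. -/
def IsSPC {k : ℕ} (A : Matrix (Fin k × Fin k) (Fin k × Fin k) ℂ) : Prop :=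
  A.PosSemidef ∧ ∃ (n : ℕ) (lam : Fin n → ℝ) (γ : Fin n → Matrix (Fin k) (Fin k) ℂ),
    IsHermitianSchmidtDecomposition A lam γ γ

/-- `D = ∑ i, γ' i ⊗ γ' i` is a Hermitian Schmidt decomposition (all coefficients are `1`) into
positive semidefinite matrices. -/
def IsPosSchmidtDecomposition {k s : ℕ} (D : Matrix (Fin k × Fin k) (Fin k × Fin k) ℂ)
    (γ' : Fin s → Matrix (Fin k) (Fin k) ℂ) : Prop :=
  IsHermitianSchmidtDecomposition D (fun _ => 1) γ' γ' ∧ ∀ i, (γ' i).PosSemidef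

/-- The image of a matrix, as a subspace of `ℂ^k` with its standard inner product. -/
def image {k : ℕ} (M : Matrix (Fin k) (Fin k) ℂ) : Submodule ℂ (EuclideanSpace ℂ (Fin k)) :=
  LinearMap.range (Matrix.toEuclideanLin M)

/-- The matrix of the Hermitian (orthogonal) projection of `ℂ^k` onto a subspace. -/
def hermProj {k : ℕ} (U : Submodule ℂ (EuclideanSpace ℂ (Fin k))) :
    Matrix (Fin k) (Fin k) ℂ :=
  Matrix.toEuclideanLin.symm (U.starProjection : _ →ₗ[ℂ] _)

/-- The projections `V_1, …, V_{s+1}`: for the first `s` indices the projection onto the image of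
`γ' i`, and for the last index the projection onto the orthogonal complement of the sum of these
images. -/
def splitProj {k s : ℕ} (γ' : Fin s → Matrix (Fin k) (Fin k) ℂ) :
    Fin (s + 1) → Matrix (Fin k) (Fin k) ℂ :=
  Fin.snoc (α := fun _ => Matrix (Fin k) (Fin k) ℂ)
    (fun i => hermProj (image (γ' i))) (hermProj (⨆ i, image (γ' i))ᗮ)

end SplitDecomposition

end

/-!
Contracting the left tensor factor turns `A = ∑ λᵢ γᵢ ⊗ γᵢ` into the superoperator
`X ↦ ∑ λᵢ ⟪γᵢ, X⟫ γᵢ`, which is self-adjoint and, because `A` is positive semidefinite, has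
nonnegative matrix coefficients `⟪q, A p⟫` between positive semidefinite `p` and `q`. As in the
Perron–Frobenius theorem, its top eigenspace, the span of `γ₁, …, γₛ`, therefore contains the
positive part of each of its Hermitian elements. Moreover the support projection `V` of a positive
semidefinite eigenvector `δ` satisfies `A (V ⊗ (1 - V)) = 0`, since `A (δ ⊗ (1 - V))` is a product
of positive semidefinite matrices with trace zero. Hence `V` commutes with every `γᵢ` and cuts `A`
into two blocks.

A largest set of nonzero positive semidefinite elements of the top eigenspace with pairwise
vanishing products is a basis of it, and normalising this basis gives the decomposition of `D`.
Two orthonormal bases of the same space with nonnegative mutual inner products agree up to order,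
which gives uniqueness.
-/

namespace SplitDecomposition

open Matrix
open scoped InnerProductSpace

section PosSemidef

variable {𝕜 m : Type*} [RCLike 𝕜] [Fintype m] {A B : Matrix m m 𝕜}

theorem exists_eq_conjTranspose_mul_self (hA : A.PosSemidef) :
    ∃ P : Matrix m m 𝕜, A = Pᴴ * P := by
  classical
  open scoped MatrixOrder in
  exact CStarAlgebra.nonneg_iff_eq_star_mul_self.mp hA.nonneg

theorem trace_conjTranspose_mul_self_mul_conjTranspose_mul_self (P Q : Matrix m m 𝕜) :
    trace (Pᴴ * P * (Qᴴ * Q)) = trace ((P * Qᴴ) * (P * Qᴴ)ᴴ) := by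
  rw [conjTranspose_mul, conjTranspose_conjTranspose, Matrix.mul_assoc, trace_mul_comm]
  simp only [Matrix.mul_assoc]

theorem trace_mul_nonneg_of_posSemidef (hA : A.PosSemidef) (hB : B.PosSemidef) :
    0 ≤ trace (A * B) := by
  obtain ⟨P, rfl⟩ := exists_eq_conjTranspose_mul_self hA
  obtain ⟨Q, rfl⟩ := exists_eq_conjTranspose_mul_self hB
  rw [trace_conjTranspose_mul_self_mul_conjTranspose_mul_self]
  exact (posSemidef_self_mul_conjTranspose _).trace_nonneg

theorem mul_eq_zero_of_trace_mul_eq_zero (hA : A.PosSemidef) (hB : B.PosSemidef)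
    (h : trace (A * B) = 0) : A * B = 0 := by
  obtain ⟨P, rfl⟩ := exists_eq_conjTranspose_mul_self hA
  obtain ⟨Q, rfl⟩ := exists_eq_conjTranspose_mul_self hB
  rw [trace_conjTranspose_mul_self_mul_conjTranspose_mul_self,
    trace_mul_conjTranspose_self_eq_zero_iff] at h
  rw [Matrix.mul_assoc, ← Matrix.mul_assoc P, h, Matrix.zero_mul, Matrix.mul_zero]

theorem mul_eq_zero_comm_of_isHermitian (hA : A.IsHermitian) (hB : B.IsHermitian) :
    A * B = 0 ↔ B * A = 0 := by
  rw [← conjTranspose_eq_zero, conjTranspose_mul, hA.eq, hB.eq]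

theorem eq_zero_of_mul_self_eq_zero (hA : A.IsHermitian) (h : A * A = 0) : A = 0 := by
  rwa [← conjTranspose_mul_self_eq_zero, hA.eq]

theorem mul_eq_zero_of_sub_mul_eq_zero (hA : A.IsHermitian) (hAB : A * B = 0)
    {Z : Matrix m m 𝕜} (h : (A - B) * Z = 0) : A * Z = 0 := by
  rw [← conjTranspose_mul_self_mul_eq_zero, hA.eq]
  calc A * A * Z = A * ((A - B) * Z) := by
        rw [← Matrix.mul_assoc, Matrix.mul_sub, hAB, sub_zero]
    _ = 0 := by rw [h, Matrix.mul_zero]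

theorem exists_posSemidef_sub_posSemidef (hA : A.IsHermitian) :
    ∃ p q : Matrix m m 𝕜, p.PosSemidef ∧ q.PosSemidef ∧ p * q = 0 ∧ A = p - q := by
  classical
  open scoped MatrixOrder in
  exact ⟨A⁺, A⁻, (CFC.posPart_nonneg A).posSemidef, (CFC.negPart_nonneg A).posSemidef,
    CFC.posPart_mul_negPart A, (CFC.posPart_sub_negPart A hA).symm⟩

end PosSemidef

section Contract

variable {R m n : Type*} [CommSemiring R] [Fintype m]

/-- The contraction of the left tensor factor of `A` against `X`: `P ⊗ Q` is sent to `tr (P X) Q`.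
It turns a matrix on `m × n` into the superoperator whose spectral decomposition encodes the
Schmidt decompositions of `A`. -/
def contract : Matrix (m × n) (m × n) R →ₗ[R] Matrix m m R →ₗ[R] Matrix n n R :=
  LinearMap.mk₂ R (fun A X => of fun b d => ∑ a, ∑ c, A (a, b) (c, d) * X c a)
    (fun A A' X => by ext; simp [add_mul, Finset.sum_add_distrib])
    (fun r A X => by ext; simp [Finset.mul_sum, mul_assoc])
    (fun A X X' => by ext; simp [mul_add, Finset.sum_add_distrib])
    (fun r A X => by ext; simp [Finset.mul_sum, mul_left_comm])

theorem contract_apply_apply (A : Matrix (m × n) (m × n) R) (X : Matrix m m R) (b d : n) :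
    contract A X b d = ∑ a, ∑ c, A (a, b) (c, d) * X c a := rfl

theorem contract_kronecker (P X : Matrix m m R) (Q : Matrix n n R) :
    contract (P ⊗ₖ Q) X = trace (P * X) • Q := by
  ext b d
  simp [contract_apply_apply, trace, mul_apply, Finset.sum_mul, mul_right_comm]

theorem contract_injective :
    Function.Injective (contract : Matrix (m × n) (m × n) R → Matrix m m R →ₗ[R] Matrix n n R) := by
  classical
  intro A B h
  ext ⟨a, b⟩ ⟨c, d⟩
  have := congrFun₂ (LinearMap.congr_fun h (single c a 1)) b d
  simpa [contract_apply_apply, single_apply, ite_and] using this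

variable [Fintype n]

theorem trace_mul_kronecker (A : Matrix (m × n) (m × n) R) (X : Matrix m m R) (Y : Matrix n n R) :
    trace (A * (X ⊗ₖ Y)) = trace (contract A X * Y) := by
  simp only [trace, diag_apply, mul_apply, contract_apply_apply, kronecker_apply,
    Fintype.sum_prod_type, Finset.sum_mul, ← mul_assoc]
  calc ∑ a, ∑ b, ∑ c, ∑ d, A (a, b) (c, d) * X c a * Y d b
      = ∑ b, ∑ a, ∑ d, ∑ c, A (a, b) (c, d) * X c a * Y d b := by
        rw [Finset.sum_comm]
        exact Finset.sum_congr rfl fun b _ => Finset.sum_congr rfl fun a _ => Finset.sum_comm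
    _ = ∑ b, ∑ d, ∑ a, ∑ c, A (a, b) (c, d) * X c a * Y d b :=
        Finset.sum_congr rfl fun b _ => Finset.sum_comm

theorem contract_mul_kronecker (A : Matrix (m × n) (m × n) R) (P X : Matrix m m R)
    (Q : Matrix n n R) : contract (A * (P ⊗ₖ Q)) X = contract A (P * X) * Q := by
  refine ext_iff_trace_mul_right.mpr fun Y => ?_
  rw [← trace_mul_kronecker, Matrix.mul_assoc A, Matrix.mul_assoc (contract A _),
    ← mul_kronecker_mul, trace_mul_kronecker]

theorem contract_kronecker_mul (A : Matrix (m × n) (m × n) R) (P X : Matrix m m R)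
    (Q : Matrix n n R) : contract ((P ⊗ₖ Q) * A) X = Q * contract A (X * P) := by
  refine ext_iff_trace_mul_right.mpr fun Y => ?_
  rw [← trace_mul_kronecker, Matrix.mul_assoc, trace_mul_comm, Matrix.mul_assoc,
    ← mul_kronecker_mul, trace_mul_kronecker, Matrix.mul_assoc Q, trace_mul_comm Q,
    Matrix.mul_assoc]

end Contract

section InnerProductSpace

variable {𝕜 E ι : Type*} [RCLike 𝕜] [NormedAddCommGroup E] [InnerProductSpace 𝕜 E] [Fintype ι]
  {v : ι → E}

theorem sum_inner_smul_eq_starProjection (hv : Orthonormal 𝕜 v) {U : Submodule 𝕜 E}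
    [U.HasOrthogonalProjection] (hU : Submodule.span 𝕜 (Set.range v) = U) (x : E) :
    ∑ i, ⟪v i, x⟫_𝕜 • v i = U.starProjection x := by
  subst hU
  refine (Submodule.eq_starProjection_of_mem_orthogonal
    (Submodule.sum_mem _ fun i _ =>
      Submodule.smul_mem _ _ (Submodule.subset_span (Set.mem_range_self i))) ?_).symm
  refine (Submodule.mem_orthogonal' _ _).mpr fun u hu => ?_
  induction hu using Submodule.span_induction with
  | mem u hu =>
    obtain ⟨i, rfl⟩ := hu
    rw [inner_sub_left, hv.inner_left_fintype, inner_conj_symm, sub_self]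
  | zero => exact inner_zero_right _
  | add u w _ _ hu hw => rw [inner_add_right, hu, hw, add_zero]
  | smul c u _ hu => rw [inner_smul_right, hu, mul_zero]

theorem sum_smul_inner_eq_smul_of_le (hv : Orthonormal 𝕜 v) {c : ι → ℝ} {L : ℝ} (hL : 0 ≤ L)
    (hc : ∀ i, 0 ≤ c i) (hcL : ∀ i, c i ≤ L) {x : E}
    (h : L * ‖x‖ ^ 2 ≤ RCLike.re ⟪x, ∑ i, ((c i : 𝕜) * ⟪v i, x⟫_𝕜) • v i⟫_𝕜) :
    ∑ i, ((c i : 𝕜) * ⟪v i, x⟫_𝕜) • v i = (L : 𝕜) • x := by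
  set y := ∑ i, ((c i : 𝕜) * ⟪v i, x⟫_𝕜) • v i with hy
  have inner_y : RCLike.re ⟪x, y⟫_𝕜 = ∑ i, c i * ‖⟪v i, x⟫_𝕜‖ ^ 2 := by
    simp only [hy, inner_sum, inner_smul_right, mul_assoc, inner_mul_symm_re_eq_norm, map_sum,
      RCLike.re_ofReal_mul, norm_mul, norm_inner_symm x, sq]
  have norm_y : ‖y‖ ^ 2 = ∑ i, c i ^ 2 * ‖⟪v i, x⟫_𝕜‖ ^ 2 := by
    rw [← inner_self_eq_norm_sq (𝕜 := 𝕜), hy, hv.inner_sum, map_sum]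
    simp only [RCLike.conj_mul, norm_mul, RCLike.norm_ofReal]
    norm_cast
    simp only [mul_pow, sq_abs]
  have norm_y_le : ‖y‖ ^ 2 ≤ L * RCLike.re ⟪x, y⟫_𝕜 := by
    rw [norm_y, inner_y, Finset.mul_sum]
    refine Finset.sum_le_sum fun i _ => ?_
    rw [sq (c i), ← mul_assoc]
    gcongr
    exacts [hc i, hcL i]
  have norm_sub : ‖(L : 𝕜) • x - y‖ ^ 2 =
      L ^ 2 * ‖x‖ ^ 2 - 2 * (L * RCLike.re ⟪x, y⟫_𝕜) + ‖y‖ ^ 2 := by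
    rw [norm_sub_sq (𝕜 := 𝕜), inner_smul_left, RCLike.conj_ofReal, RCLike.re_ofReal_mul, norm_smul,
      RCLike.norm_ofReal, mul_pow, sq_abs]
  refine (sub_eq_zero.mp (norm_eq_zero.mp (pow_eq_zero_iff two_ne_zero |>.mp ?_))).symm
  nlinarith only [sq_nonneg ‖(L : 𝕜) • x - y‖, mul_le_mul_of_nonneg_left h hL, norm_y_le, norm_sub]

theorem sum_smul_inner_eq_smul_iff (hv : Orthonormal 𝕜 v) (c : ι → 𝕜) {L : 𝕜} (hL : L ≠ 0) {x : E} :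
    ∑ i, (c i * ⟪v i, x⟫_𝕜) • v i = L • x ↔ x ∈ Submodule.span 𝕜 (v '' {i | c i = L}) := by
  constructor
  · intro h
    have hi (i : ι) : c i * ⟪v i, x⟫_𝕜 = L * ⟪v i, x⟫_𝕜 := by
      have := congrArg (inner 𝕜 (v i)) h
      rwa [hv.inner_right_fintype, inner_smul_right] at this
    rw [← inv_smul_smul₀ hL x, ← h]
    refine Submodule.smul_mem _ _ (Submodule.sum_mem _ fun i _ => ?_)
    by_cases hx : ⟪v i, x⟫_𝕜 = 0
    · simp [hx]
    · exact Submodule.smul_mem _ _ (Submodule.subset_span ⟨i, mul_right_cancel₀ hx (hi i), rfl⟩)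
  · intro h
    induction h using Submodule.span_induction with
    | mem u hu =>
      obtain ⟨i, hi, rfl⟩ := hu
      classical
      simp [orthonormal_iff_ite.mp hv, show c i = L from hi]
    | zero => simp
    | add u w _ _ hu hw => simp [inner_add_right, mul_add, add_smul, Finset.sum_add_distrib, hu, hw]
    | smul a u _ hu =>
      rw [smul_comm, ← hu, Finset.smul_sum]
      simp only [inner_smul_right, smul_smul, mul_left_comm]

theorem sum_inner_smul_eq_self_iff (hv : Orthonormal 𝕜 v) {x : E} :
    ∑ i, ⟪v i, x⟫_𝕜 • v i = x ↔ x ∈ Submodule.span 𝕜 (Set.range v) := by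
  simpa using sum_smul_inner_eq_smul_iff hv (fun _ => 1) one_ne_zero (x := x)

theorem exists_perm_eq_of_inner_nonneg {κ : Type*} [Finite κ] {f g : κ → E}
    (hf : Orthonormal 𝕜 f) (hg : Orthonormal 𝕜 g)
    (hspan : Submodule.span 𝕜 (Set.range f) = Submodule.span 𝕜 (Set.range g))
    (hnonneg : ∀ i j, 0 ≤ ⟪f j, g i⟫_𝕜) : ∃ σ : Equiv.Perm κ, ∀ i, g i = f (σ i) := by
  have := Fintype.ofFinite κ
  have hsum (i : κ) : ∑ j, ⟪f j, g i⟫_𝕜 • f j = g i :=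
    (sum_inner_smul_eq_self_iff hf).mpr (hspan ▸ Submodule.subset_span (Set.mem_range_self i))
  have hmul {i i' : κ} (hne : i ≠ i') (j : κ) : ⟪f j, g i⟫_𝕜 * ⟪f j, g i'⟫_𝕜 = 0 := by
    have hzero : ∑ j, ⟪f j, g i⟫_𝕜 * ⟪f j, g i'⟫_𝕜 = 0 := by
      rw [← hg.2 hne, ← hsum i, ← hsum i', hf.inner_sum]
      simp only [hsum, RCLike.conj_eq_iff_im.mpr (RCLike.nonneg_iff.mp (hnonneg _ _)).2]
    exact (Finset.sum_eq_zero_iff_of_nonneg fun j _ => mul_nonneg (hnonneg i j) (hnonneg i' j)).mp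
      hzero j (Finset.mem_univ j)
  have hexists (i : κ) : ∃ j, ⟪f j, g i⟫_𝕜 ≠ 0 := by
    by_contra! h
    exact hg.ne_zero i (by simpa [h] using (hsum i).symm)
  choose σ hσ using hexists
  have hinj : Function.Injective σ := fun i i' h => by
    by_contra hne
    exact mul_ne_zero (hσ i) (h ▸ hσ i') (hmul hne (σ i))
  have hbij := Finite.injective_iff_bijective.mp hinj
  have hsmul (i : κ) : g i = ⟪f (σ i), g i⟫_𝕜 • f (σ i) := by
    rw [← Finset.sum_eq_single_of_mem (f := fun j => ⟪f j, g i⟫_𝕜 • f j) (σ i) (Finset.mem_univ _),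
      hsum]
    intro j _ hj
    obtain ⟨i', rfl⟩ := hbij.2 j
    have hne : i ≠ i' := fun h => hj (h ▸ rfl)
    rw [(mul_eq_zero.mp (hmul hne (σ i'))).resolve_right (hσ i'), zero_smul]
  refine ⟨Equiv.ofBijective σ hbij, fun i => ?_⟩
  have hnorm : ‖⟪f (σ i), g i⟫_𝕜‖ = 1 := by
    have := congrArg norm (hsmul i)
    rwa [norm_smul, hg.1, hf.1, mul_one, eq_comm] at this
  rw [Equiv.ofBijective_apply, hsmul i, ← RCLike.norm_of_nonneg' (hnonneg i (σ i)), hnorm,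
    RCLike.ofReal_one, one_smul]

theorem exists_orthogonalGroup_pairwise_inner_eq_zero [DecidableEq ι]
    (hv : ∀ i j, (RCLike.re ⟪v i, v j⟫_𝕜 : 𝕜) = ⟪v i, v j⟫_𝕜) :
    ∃ U ∈ orthogonalGroup ι ℝ, Pairwise fun i j =>
      ⟪∑ l, (U l i : 𝕜) • v l, ∑ l, (U l j : 𝕜) • v l⟫_𝕜 = 0 := by
  let G : Matrix ι ι ℝ := of fun i j => RCLike.re ⟪v i, v j⟫_𝕜
  have hG : G.IsHermitian := by
    ext i j
    simp only [G, conjTranspose_apply, of_apply, star_trivial]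
    exact inner_re_symm _ _
  refine ⟨hG.eigenvectorUnitary.1, hG.eigenvectorUnitary.2, fun i j hij => ?_⟩
  set U := hG.eigenvectorUnitary.1
  have hdiag : star U * G * U = diagonal hG.eigenvalues := by
    have := hG.conjStarAlgAut_star_eigenvectorUnitary
    rwa [Unitary.conjStarAlgAut_star_apply] at this
  calc ⟪∑ l, (U l i : 𝕜) • v l, ∑ l, (U l j : 𝕜) • v l⟫_𝕜
      = ((star U * G * U) i j : ℝ) := by
        simp only [sum_inner, inner_sum, inner_smul_left, inner_smul_right, RCLike.conj_ofReal,
          mul_apply, star_apply, star_trivial, Finset.sum_mul, Finset.mul_sum, G, of_apply]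
        push_cast
        simp only [hv]
        exact Finset.sum_congr rfl fun l _ => Finset.sum_congr rfl fun m _ => by ring
    _ = 0 := by rw [hdiag, diagonal_apply_ne _ hij, RCLike.ofReal_zero]

end InnerProductSpace

section HermProj

variable {k : ℕ}

theorem toEuclideanLin_hermProj (U : Submodule ℂ (EuclideanSpace ℂ (Fin k))) :
    toEuclideanLin (hermProj U) = U.starProjection.toLinearMap :=
  toEuclideanLin.apply_symm_apply _

theorem toEuclideanLin_mul {m : Type*} [Fintype m] [DecidableEq m] (M N : Matrix m m ℂ) :
    toEuclideanLin (M * N) = toEuclideanLin M ∘ₗ toEuclideanLin N :=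
  toLpLin_mul_same 2 M N

theorem isHermitian_hermProj (U : Submodule ℂ (EuclideanSpace ℂ (Fin k))) :
    (hermProj U).IsHermitian := by
  rw [← isSymmetric_toEuclideanLin_iff, toEuclideanLin_hermProj]
  exact U.starProjection_isSymmetric

theorem hermProj_mul_self (U : Submodule ℂ (EuclideanSpace ℂ (Fin k))) :
    hermProj U * hermProj U = hermProj U := by
  refine toEuclideanLin.injective ?_
  rw [toEuclideanLin_mul, toEuclideanLin_hermProj]
  exact congrArg ContinuousLinearMap.toLinearMap U.isIdempotentElem_starProjection

theorem hermProj_orthogonal (U : Submodule ℂ (EuclideanSpace ℂ (Fin k))) :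
    hermProj Uᗮ = 1 - hermProj U := by
  refine toEuclideanLin.injective ?_
  rw [map_sub, toEuclideanLin_hermProj, toEuclideanLin_hermProj, U.starProjection_orthogonal,
    toLpLin_one]
  rfl

theorem posSemidef_hermProj (U : Submodule ℂ (EuclideanSpace ℂ (Fin k))) :
    (hermProj U).PosSemidef := by
  have := posSemidef_conjTranspose_mul_self (hermProj U)
  rwa [(isHermitian_hermProj U).eq, hermProj_mul_self] at this

theorem hermProj_image_mul (M : Matrix (Fin k) (Fin k) ℂ) : hermProj (image M) * M = M := by
  refine toEuclideanLin.injective (LinearMap.ext fun x => ?_)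
  rw [toEuclideanLin_mul, toEuclideanLin_hermProj]
  exact Submodule.starProjection_eq_self_iff.mpr ⟨x, rfl⟩

theorem mul_hermProj_image {M : Matrix (Fin k) (Fin k) ℂ} (hM : M.IsHermitian) :
    M * hermProj (image M) = M := by
  have := congrArg conjTranspose (hermProj_image_mul M)
  rwa [conjTranspose_mul, hM.eq, (isHermitian_hermProj _).eq] at this

theorem exists_hermProj_image_eq_mul (M : Matrix (Fin k) (Fin k) ℂ) :
    ∃ N, hermProj (image M) = M * N := by
  obtain ⟨g, hg⟩ := Module.projective_lifting_property (toEuclideanLin M).rangeRestrict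
    (image M).orthogonalProjectionOnto.toLinearMap (toEuclideanLin M).surjective_rangeRestrict
  refine ⟨toEuclideanLin.symm g, toEuclideanLin.injective ?_⟩
  rw [toEuclideanLin_mul, toEuclideanLin_hermProj, LinearEquiv.apply_symm_apply]
  exact (congrArg (fun h => (image M).subtype ∘ₗ h) hg).symm

theorem hermProj_image_mul_eq_zero {M Z : Matrix (Fin k) (Fin k) ℂ} (hM : M.IsHermitian)
    (h : M * Z = 0) : hermProj (image M) * Z = 0 := by
  obtain ⟨N, hN⟩ := exists_hermProj_image_eq_mul M
  rw [← (isHermitian_hermProj _).eq, hN, conjTranspose_mul, hM.eq, Matrix.mul_assoc, h,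
    Matrix.mul_zero]

theorem isOrtho_image_of_mul_eq_zero {M N : Matrix (Fin k) (Fin k) ℂ} (hM : M.IsHermitian)
    (h : M * N = 0) : image M ⟂ image N := by
  rw [Submodule.isOrtho_iff_inner_eq]
  rintro _ ⟨x, rfl⟩ _ ⟨y, rfl⟩
  rw [isSymmetric_toEuclideanLin_iff.mpr hM x, ← LinearMap.comp_apply, ← toEuclideanLin_mul, h,
    map_zero, LinearMap.zero_apply, inner_zero_right]

theorem hermProj_iSup {ι : Type*} [Fintype ι] {U : ι → Submodule ℂ (EuclideanSpace ℂ (Fin k))}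
    (hU : OrthogonalFamily ℂ (fun i => U i) fun i => (U i).subtypeₗᵢ) :
    hermProj (⨆ i, U i) = ∑ i, hermProj (U i) := by
  refine toEuclideanLin.injective (LinearMap.ext fun x => ?_)
  simp only [map_sum, toEuclideanLin_hermProj, LinearMap.sum_apply, ContinuousLinearMap.coe_coe]
  rw [← hU.sum_projection_of_mem_iSup _ ((⨆ i, U i).starProjection_apply_mem x)]
  refine Finset.sum_congr rfl fun i _ => ?_
  rw [← ContinuousLinearMap.comp_apply,
    Submodule.starProjection_comp_starProjection_of_le (le_iSup U i)]

variable {s : ℕ}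

theorem forall_splitProj {P : Matrix (Fin k) (Fin k) ℂ → Prop}
    {f : Fin s → Matrix (Fin k) (Fin k) ℂ} (himage : ∀ i, P (hermProj (image (f i))))
    (hcompl : P (hermProj (⨆ i, image (f i))ᗮ)) (i : Fin (s + 1)) : P (splitProj f i) := by
  induction i using Fin.lastCases with
  | last => rwa [splitProj, Fin.snoc_last]
  | cast i => rw [splitProj, Fin.snoc_castSucc]; exact himage i

theorem isHermitian_splitProj (f : Fin s → Matrix (Fin k) (Fin k) ℂ) (i : Fin (s + 1)) :
    (splitProj f i).IsHermitian :=
  forall_splitProj (fun _ => isHermitian_hermProj _) (isHermitian_hermProj _) i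

theorem splitProj_mul_self (f : Fin s → Matrix (Fin k) (Fin k) ℂ) (i : Fin (s + 1)) :
    splitProj f i * splitProj f i = splitProj f i :=
  forall_splitProj (P := fun V => V * V = V) (fun _ => hermProj_mul_self _)
    (hermProj_mul_self _) i

theorem sum_splitProj {f : Fin s → Matrix (Fin k) (Fin k) ℂ}
    (hf : OrthogonalFamily ℂ (fun i => image (f i)) fun i => (image (f i)).subtypeₗᵢ) :
    ∑ i, splitProj f i = 1 := by
  simp only [splitProj, Fin.sum_univ_castSucc, Fin.snoc_castSucc, Fin.snoc_last,
    hermProj_orthogonal, hermProj_iSup hf, add_sub_cancel]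

end HermProj

noncomputable local instance {m : Type*} [Fintype m] [DecidableEq m] :
    NormedAddCommGroup (Matrix m m ℂ) :=
  toMatrixNormedAddCommGroup 1 PosDef.one

/-- The trace inner product. It is conjugate linear in its first argument, so that `⟪X, Y⟫` is
`tr (Y X*)`. -/
noncomputable local instance {m : Type*} [Fintype m] [DecidableEq m] :
    InnerProductSpace ℂ (Matrix m m ℂ) :=
  toMatrixInnerProductSpace 1 PosSemidef.one

section TraceInner

variable {m : Type*} [Fintype m] [DecidableEq m]

theorem inner_eq_trace (X Y : Matrix m m ℂ) : ⟪X, Y⟫_ℂ = trace (Y * Xᴴ) := by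
  change trace (Y * 1 * Xᴴ) = _
  rw [Matrix.mul_one]

theorem inner_eq_trace_mul {X : Matrix m m ℂ} (hX : X.IsHermitian)
    (Y : Matrix m m ℂ) : ⟪X, Y⟫_ℂ = trace (X * Y) := by
  rw [inner_eq_trace, hX.eq, trace_mul_comm]

theorem traceOrthonormal_iff_orthonormal {k n : ℕ} {γ : Fin n → Matrix (Fin k) (Fin k) ℂ} :
    TraceOrthonormal γ ↔ Orthonormal ℂ γ := by
  simp only [TraceOrthonormal, orthonormal_iff_ite, inner_eq_trace]
  rw [forall_comm]
  simp only [eq_comm]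

theorem re_inner_of_isHermitian {X Y : Matrix m m ℂ} (hX : X.IsHermitian)
    (hY : Y.IsHermitian) : ((RCLike.re ⟪X, Y⟫_ℂ : ℝ) : ℂ) = ⟪X, Y⟫_ℂ := by
  refine Complex.conj_eq_iff_re.mp ?_
  rw [inner_conj_symm, inner_eq_trace_mul hX, inner_eq_trace_mul hY, trace_mul_comm]

theorem inner_nonneg_of_posSemidef {X Y : Matrix m m ℂ} (hX : X.PosSemidef)
    (hY : Y.PosSemidef) : 0 ≤ ⟪X, Y⟫_ℂ := by
  rw [inner_eq_trace_mul hX.isHermitian]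
  exact trace_mul_nonneg_of_posSemidef hX hY

theorem inner_eq_zero_iff_mul_eq_zero {X Y : Matrix m m ℂ} (hX : X.PosSemidef)
    (hY : Y.PosSemidef) : ⟪X, Y⟫_ℂ = 0 ↔ X * Y = 0 := by
  rw [inner_eq_trace_mul hX.isHermitian]
  exact ⟨mul_eq_zero_of_trace_mul_eq_zero hX hY, fun h => by rw [h, trace_zero]⟩

theorem inner_contract_nonneg {A : Matrix (m × m) (m × m) ℂ} (hA : A.PosSemidef)
    {p q : Matrix m m ℂ} (hp : p.PosSemidef) (hq : q.PosSemidef) :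
    0 ≤ ⟪q, contract A p⟫_ℂ := by
  rw [inner_eq_trace_mul hq.isHermitian, trace_mul_comm, ← trace_mul_kronecker]
  exact trace_mul_nonneg_of_posSemidef hA (hp.kronecker hq)

theorem contract_sum_smul_kronecker {ι n : Type*} [Fintype ι] (c : ι → ℂ)
    {P : ι → Matrix m m ℂ} (hP : ∀ i, (P i).IsHermitian) (Q : ι → Matrix n n ℂ) (X : Matrix m m ℂ) :
    contract (∑ i, c i • (P i ⊗ₖ Q i)) X = ∑ i, (c i * ⟪P i, X⟫_ℂ) • Q i := by
  simp only [map_sum, map_smul, LinearMap.sum_apply, LinearMap.smul_apply, contract_kronecker,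
    smul_smul, inner_eq_trace_mul (hP _)]

namespace IsHermitianSchmidtDecomposition

variable {k n : ℕ} {A : Matrix (Fin k × Fin k) (Fin k × Fin k) ℂ} {lam : Fin n → ℝ}
  {γ : Fin n → Matrix (Fin k) (Fin k) ℂ} {L : ℝ}

theorem contract_apply (h : IsHermitianSchmidtDecomposition A lam γ γ)
    (X : Matrix (Fin k) (Fin k) ℂ) :
    contract A X = ∑ i, ((lam i : ℂ) * ⟪γ i, X⟫_ℂ) • γ i := by
  rw [h.eq_sum, contract_sum_smul_kronecker _ h.isHermitian_left]

theorem orthonormal (h : IsHermitianSchmidtDecomposition A lam γ γ) : Orthonormal ℂ γ :=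
  traceOrthonormal_iff_orthonormal.mp h.orthonormal_left

theorem eigenspace_contract (h : IsHermitianSchmidtDecomposition A lam γ γ) (hL : L ≠ 0) :
    Module.End.eigenspace (contract A) (L : ℂ) = Submodule.span ℂ (γ '' {i | lam i = L}) := by
  ext X
  rw [Module.End.mem_eigenspace_iff, h.contract_apply,
    sum_smul_inner_eq_smul_iff h.orthonormal _ (Complex.ofReal_ne_zero.mpr hL)]
  simp only [Complex.ofReal_inj]

theorem posPart_mem_eigenspace (h : IsHermitianSchmidtDecomposition A lam γ γ)
    (hA : A.PosSemidef) (hL : 0 ≤ L) (hlam : ∀ i, lam i ≤ L) {p q : Matrix (Fin k) (Fin k) ℂ}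
    (hp : p.PosSemidef) (hq : q.PosSemidef) (hpq : p * q = 0)
    (hmem : p - q ∈ Module.End.eigenspace (contract A) (L : ℂ)) :
    p ∈ Module.End.eigenspace (contract A) (L : ℂ) := by
  have add_mem : p + q ∈ Module.End.eigenspace (contract A) (L : ℂ) := by
    have norm_eq : ‖p + q‖ = ‖p - q‖ :=
      (norm_sub_eq_norm_add
        (inner_eq_zero_symm.mp ((inner_eq_zero_iff_mul_eq_zero hp hq).mpr hpq))).symm
    have norm_le : L * ‖p + q‖ ^ 2 ≤ RCLike.re ⟪p + q, contract A (p + q)⟫_ℂ :=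
      calc L * ‖p + q‖ ^ 2
          = RCLike.re ⟪p - q, contract A (p - q)⟫_ℂ := by
            rw [Module.End.mem_eigenspace_iff.mp hmem, inner_smul_right, norm_eq,
              ← inner_self_eq_norm_sq (𝕜 := ℂ)]
            exact (Complex.re_ofReal_mul _ _).symm
        _ ≤ RCLike.re ⟪p + q, contract A (p + q)⟫_ℂ := by
            have hpAq := (RCLike.nonneg_iff.mp (inner_contract_nonneg hA hq hp)).1
            have hqAp := (RCLike.nonneg_iff.mp (inner_contract_nonneg hA hp hq)).1
            simp only [map_add, map_sub, inner_add_left, inner_add_right, inner_sub_left,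
              inner_sub_right]
            linarith
    rw [h.contract_apply] at norm_le
    rw [Module.End.mem_eigenspace_iff, h.contract_apply]
    exact sum_smul_inner_eq_smul_of_le h.orthonormal hL (fun i => (h.pos i).le) hlam norm_le
  have hp_eq : p = (2⁻¹ : ℂ) • ((p + q) + (p - q)) := by module
  rw [hp_eq]
  exact Submodule.smul_mem _ _ (Submodule.add_mem _ add_mem hmem)

end IsHermitianSchmidtDecomposition

end TraceInner

section Splitting

/-- The matrices `V` for which the four products of `A ∈ M_k ⊗ M_k` with `V ⊗ 1` and `1 ⊗ V`, on
either side, coincide. When such matrices are idempotents that sum to `1`, they cut `A` into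
blocks. -/
def splittingSubmodule {R m : Type*} [CommRing R] [Fintype m] [DecidableEq m]
    (A : Matrix (m × m) (m × m) R) : Submodule R (Matrix m m R) where
  carrier := {V | (V ⊗ₖ 1) * A = A * (V ⊗ₖ 1) ∧ (1 ⊗ₖ V) * A = A * (1 ⊗ₖ V) ∧
    A * (V ⊗ₖ 1) = A * (1 ⊗ₖ V)}
  add_mem' := by
    rintro V W ⟨hV₁, hV₂, hV₃⟩ ⟨hW₁, hW₂, hW₃⟩
    simp only [Set.mem_ofPred_eq, add_kronecker, kronecker_add, Matrix.add_mul, Matrix.mul_add,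
      hV₁, hV₂, hV₃, hW₁, hW₂, hW₃, and_self]
  zero_mem' := by
    simp only [Set.mem_ofPred_eq, zero_kronecker, kronecker_zero, Matrix.zero_mul, Matrix.mul_zero,
      and_self]
  smul_mem' := by
    rintro c V ⟨hV₁, hV₂, hV₃⟩
    simp only [Set.mem_ofPred_eq, smul_kronecker, kronecker_smul, Matrix.smul_mul, Matrix.mul_smul,
      hV₁, hV₂, hV₃, and_self]

section CommRing

variable {R m : Type*} [CommRing R] [Fintype m] [DecidableEq m] {A : Matrix (m × m) (m × m) R}
  {V : Matrix m m R}

theorem one_mem_splittingSubmodule : (1 : Matrix m m R) ∈ splittingSubmodule A :=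
  ⟨by simp, by simp, rfl⟩

theorem kronecker_self_mul_mul_kronecker_self (hV : V ∈ splittingSubmodule A) (hVV : V * V = V) :
    (V ⊗ₖ V) * A * (V ⊗ₖ V) = A * (V ⊗ₖ 1) := by
  obtain ⟨hleft, hright, hswap⟩ := hV
  have hsq : (V ⊗ₖ 1) * (V ⊗ₖ 1) = V ⊗ₖ (1 : Matrix m m R) := by
    rw [← mul_kronecker_mul, hVV, Matrix.mul_one]
  have hmul : (V ⊗ₖ V) = (1 ⊗ₖ V) * (V ⊗ₖ 1) := by
    rw [← mul_kronecker_mul, Matrix.one_mul, Matrix.mul_one]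
  have hA : A * (V ⊗ₖ V) = A * (V ⊗ₖ 1) := by
    rw [hmul, ← Matrix.mul_assoc, ← hswap, Matrix.mul_assoc, hsq]
  rw [Matrix.mul_assoc, hA, ← hleft, ← Matrix.mul_assoc, hmul, Matrix.mul_assoc (1 ⊗ₖ V), hsq,
    Matrix.mul_assoc, hleft, ← Matrix.mul_assoc, hright, ← hswap, Matrix.mul_assoc, hsq]

theorem eq_sum_kronecker_self_mul_mul_kronecker_self {ι : Type*} [Fintype ι]
    {V : ι → Matrix m m R} (hV : ∀ i, V i ∈ splittingSubmodule A) (hVV : ∀ i, V i * V i = V i)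
    (hsum : ∑ i, V i = 1) : A = ∑ i, (V i ⊗ₖ V i) * A * (V i ⊗ₖ V i) := by
  have sum_kronecker : ∑ i, V i ⊗ₖ (1 : Matrix m m R) = (∑ i, V i) ⊗ₖ 1 := by
    ext
    simp [Matrix.sum_apply, Finset.sum_mul]
  simp only [kronecker_self_mul_mul_kronecker_self (hV _) (hVV _)]
  rw [← Matrix.mul_sum, sum_kronecker, hsum, one_kronecker_one, Matrix.mul_one]

theorem contract_mul_of_mem_splittingSubmodule (hV : V ∈ splittingSubmodule A) (X : Matrix m m R) :
    contract A (V * X) = contract A X * V := by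
  simpa [contract_mul_kronecker] using LinearMap.congr_fun (congrArg contract hV.2.2) X

end CommRing

section Field

variable {K m : Type*} [Field K] [Fintype m] [DecidableEq m] {A : Matrix (m × m) (m × m) K}
  {V X : Matrix m m K} {μ : K}

theorem commute_of_mem_eigenspace_contract (hV : V ∈ splittingSubmodule A) (hμ : μ ≠ 0)
    (hX : X ∈ Module.End.eigenspace (contract A) μ) : V * X = X * V := by
  have hright : V * contract A X = contract A X * V := by
    simpa [contract_mul_kronecker, contract_kronecker_mul] using
      LinearMap.congr_fun (congrArg contract hV.2.1) X
  rw [Module.End.mem_eigenspace_iff.mp hX, Matrix.mul_smul, Matrix.smul_mul] at hright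
  exact smul_right_injective _ hμ hright

theorem mul_mem_eigenspace_contract (hV : V ∈ splittingSubmodule A) (hμ : μ ≠ 0)
    (hX : X ∈ Module.End.eigenspace (contract A) μ) :
    V * X ∈ Module.End.eigenspace (contract A) μ := by
  rw [Module.End.mem_eigenspace_iff, contract_mul_of_mem_splittingSubmodule hV,
    Module.End.mem_eigenspace_iff.mp hX, Matrix.smul_mul,
    commute_of_mem_eigenspace_contract hV hμ hX]

end Field

theorem eq_zero_of_sum_smul_kronecker_conjTranspose {𝕜 ι l m : Type*} [RCLike 𝕜] [Fintype ι]
    {c : ι → ℝ} (hc : ∀ i, 0 < c i) {P : ι → Matrix l m 𝕜}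
    (h : ∑ i, (c i : 𝕜) • (P i ⊗ₖ (P i)ᴴ) = 0) (i : ι) : P i = 0 := by
  ext a b
  have hsum : ∑ j, c j * ‖P j a b‖ ^ 2 = 0 := by
    have := congrFun₂ h (a, b) (b, a)
    simp only [Matrix.sum_apply, Matrix.smul_apply, kronecker_apply, conjTranspose_apply,
      smul_eq_mul, RCLike.star_def, RCLike.mul_conj, Matrix.zero_apply] at this
    exact_mod_cast this
  have hi := (Finset.sum_eq_zero_iff_of_nonneg
    fun j _ => mul_nonneg (hc j).le (sq_nonneg _)).mp hsum i (Finset.mem_univ i)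
  simpa [(hc i).ne'] using hi

namespace IsHermitianSchmidtDecomposition

variable {k n : ℕ} {A : Matrix (Fin k × Fin k) (Fin k × Fin k) ℂ} {lam : Fin n → ℝ}
  {γ : Fin n → Matrix (Fin k) (Fin k) ℂ} {δ : Matrix (Fin k) (Fin k) ℂ} {μ : ℂ}

theorem trace_contract_mul_comm (h : IsHermitianSchmidtDecomposition A lam γ γ)
    (X Y : Matrix (Fin k) (Fin k) ℂ) :
    trace (contract A X * Y) = trace (contract A Y * X) := by
  simp only [h.contract_apply, Finset.sum_mul, trace_sum, smul_mul, trace_smul, smul_eq_mul,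
    inner_eq_trace_mul (h.isHermitian_left _)]
  exact Finset.sum_congr rfl fun i _ => by ring

theorem mul_kronecker_eq_zero (h : IsHermitianSchmidtDecomposition A lam γ γ) (hA : A.PosSemidef)
    (hδ : δ.PosSemidef) (hmem : δ ∈ Module.End.eigenspace (contract A) μ) :
    A * (hermProj (image δ) ⊗ₖ (1 - hermProj (image δ))) = 0 ∧
      A * ((1 - hermProj (image δ)) ⊗ₖ hermProj (image δ)) = 0 := by
  obtain ⟨N, hN⟩ := exists_hermProj_image_eq_mul δ
  have hcompl : (1 - hermProj (image δ)).PosSemidef :=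
    hermProj_orthogonal (image δ) ▸ posSemidef_hermProj _
  have trace_eq : trace (contract A δ * (1 - hermProj (image δ))) = 0 := by
    rw [Module.End.mem_eigenspace_iff.mp hmem, smul_mul, Matrix.mul_sub, Matrix.mul_one,
      mul_hermProj_image hδ.isHermitian, sub_self, smul_zero, trace_zero]
  have hright : A * (δ ⊗ₖ (1 - hermProj (image δ))) = 0 :=
    mul_eq_zero_of_trace_mul_eq_zero hA (hδ.kronecker hcompl) (by rwa [trace_mul_kronecker])
  have hleft : A * ((1 - hermProj (image δ)) ⊗ₖ δ) = 0 :=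
    mul_eq_zero_of_trace_mul_eq_zero hA (hcompl.kronecker hδ)
      (by rwa [trace_mul_kronecker, h.trace_contract_mul_comm])
  generalize 1 - hermProj (image δ) = W at hright hleft ⊢
  constructor
  · rw [hN, ← Matrix.mul_one W, mul_kronecker_mul, ← Matrix.mul_assoc, hright, Matrix.zero_mul]
  · rw [hN, ← Matrix.mul_one W, mul_kronecker_mul, ← Matrix.mul_assoc, hleft, Matrix.zero_mul]

theorem hermProj_mul_comm (h : IsHermitianSchmidtDecomposition A lam γ γ) (hA : A.PosSemidef)
    (hδ : δ.PosSemidef) (hmem : δ ∈ Module.End.eigenspace (contract A) μ) (i : Fin n) :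
    hermProj (image δ) * γ i = γ i * hermProj (image δ) := by
  have hAV := (h.mul_kronecker_eq_zero hA hδ hmem).1
  have hV := isHermitian_hermProj (image δ)
  set V := hermProj (image δ)
  have hP : (1 - V) * γ i * V = 0 := by
    refine eq_zero_of_sum_smul_kronecker_conjTranspose (𝕜 := ℂ) h.pos
      (P := fun i => (1 - V) * γ i * V) ?_ i
    calc ∑ i, (lam i : ℂ) • (((1 - V) * γ i * V) ⊗ₖ ((1 - V) * γ i * V)ᴴ)
        = ((1 - V) ⊗ₖ V) * (A * (V ⊗ₖ (1 - V))) := by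
          simp only [h.eq_sum, Matrix.sum_mul, Matrix.mul_sum, Matrix.smul_mul, Matrix.mul_smul,
            ← mul_kronecker_mul, conjTranspose_mul, conjTranspose_sub, conjTranspose_one,
            (h.isHermitian_left _).eq, hV.eq, Matrix.mul_assoc]
      _ = 0 := by rw [hAV, Matrix.mul_zero]
  have hVγV : γ i * V = V * γ i * V := by
    rwa [Matrix.sub_mul, Matrix.sub_mul, Matrix.one_mul, sub_eq_zero] at hP
  have := congrArg conjTranspose hVγV
  simp only [conjTranspose_mul, (h.isHermitian_left i).eq, hV.eq, ← Matrix.mul_assoc] at this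
  rw [this, hVγV]

theorem hermProj_image_mem_splittingSubmodule (h : IsHermitianSchmidtDecomposition A lam γ γ)
    (hA : A.PosSemidef) (hδ : δ.PosSemidef)
    (hmem : δ ∈ Module.End.eigenspace (contract A) μ) :
    hermProj (image δ) ∈ splittingSubmodule A := by
  obtain ⟨hright, hleft⟩ := h.mul_kronecker_eq_zero hA hδ hmem
  refine ⟨?_, ?_, ?_⟩
  · simp only [h.eq_sum, Matrix.sum_mul, Matrix.mul_sum, Matrix.smul_mul, Matrix.mul_smul,
      ← mul_kronecker_mul, Matrix.one_mul, Matrix.mul_one, h.hermProj_mul_comm hA hδ hmem]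
  · simp only [h.eq_sum, Matrix.sum_mul, Matrix.mul_sum, Matrix.smul_mul, Matrix.mul_smul,
      ← mul_kronecker_mul, Matrix.one_mul, Matrix.mul_one, h.hermProj_mul_comm hA hδ hmem]
  · rw [← sub_add_cancel 1 (hermProj (image δ)), kronecker_add, add_kronecker, Matrix.mul_add,
      Matrix.mul_add, hright, hleft]

end IsHermitianSchmidtDecomposition

end Splitting

section SupportClosed

variable {k : ℕ}

/-- A subspace of `M_k` that is spanned by Hermitian matrices, contains the positive part of each
of its Hermitian elements, and is commuted with and preserved by the support projections
`hermProj (image δ)` of its positive semidefinite elements `δ`. -/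
structure IsSupportClosed (W : Submodule ℂ (Matrix (Fin k) (Fin k) ℂ)) : Prop where
  le_span_isHermitian : W ≤ Submodule.span ℂ {X ∈ W | X.IsHermitian}
  posPart_mem : ∀ ⦃p q : Matrix (Fin k) (Fin k) ℂ⦄, p.PosSemidef → q.PosSemidef → p * q = 0 →
    p - q ∈ W → p ∈ W
  hermProj_mul_comm : ∀ ⦃δ X : Matrix (Fin k) (Fin k) ℂ⦄, δ.PosSemidef → δ ∈ W → X ∈ W →
    hermProj (image δ) * X = X * hermProj (image δ)
  hermProj_mul_mem : ∀ ⦃δ X : Matrix (Fin k) (Fin k) ℂ⦄, δ.PosSemidef → δ ∈ W → X ∈ W →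
    hermProj (image δ) * X ∈ W

theorem IsHermitianSchmidtDecomposition.isSupportClosed_eigenspace {n : ℕ}
    {A : Matrix (Fin k × Fin k) (Fin k × Fin k) ℂ} {lam : Fin n → ℝ}
    {γ : Fin n → Matrix (Fin k) (Fin k) ℂ} (h : IsHermitianSchmidtDecomposition A lam γ γ)
    (hA : A.PosSemidef) {L : ℝ} (hL : 0 < L) (hlam : ∀ i, lam i ≤ L) :
    IsSupportClosed (Module.End.eigenspace (contract A) (L : ℂ)) where
  le_span_isHermitian := by
    rw [h.eigenspace_contract hL.ne']
    refine Submodule.span_mono ?_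
    rintro _ ⟨i, hi, rfl⟩
    exact ⟨Submodule.subset_span ⟨i, hi, rfl⟩, h.isHermitian_left i⟩
  posPart_mem _ _ hp hq hpq := h.posPart_mem_eigenspace hA hL.le hlam hp hq hpq
  hermProj_mul_comm _ _ hδ hδW :=
    commute_of_mem_eigenspace_contract (h.hermProj_image_mem_splittingSubmodule hA hδ hδW)
      (Complex.ofReal_ne_zero.mpr hL.ne')
  hermProj_mul_mem _ _ hδ hδW :=
    mul_mem_eigenspace_contract (h.hermProj_image_mem_splittingSubmodule hA hδ hδW)
      (Complex.ofReal_ne_zero.mpr hL.ne')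

/-- A finite set of nonzero positive semidefinite elements of `W` with pairwise vanishing
products. The sets of largest cardinality span a support closed subspace. -/
structure IsOrthogonalPosFamily (W : Submodule ℂ (Matrix (Fin k) (Fin k) ℂ))
    (S : Finset (Matrix (Fin k) (Fin k) ℂ)) : Prop where
  mem : ∀ δ ∈ S, δ ∈ W
  posSemidef : ∀ δ ∈ S, δ.PosSemidef
  ne_zero : ∀ δ ∈ S, δ ≠ 0
  mul_eq_zero : (S : Set (Matrix (Fin k) (Fin k) ℂ)).Pairwise fun δ δ' => δ * δ' = 0

variable {W : Submodule ℂ (Matrix (Fin k) (Fin k) ℂ)} {S : Finset (Matrix (Fin k) (Fin k) ℂ)}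
  {p q δ : Matrix (Fin k) (Fin k) ℂ}

namespace IsOrthogonalPosFamily

theorem mono (hS : IsOrthogonalPosFamily W S) {T : Finset (Matrix (Fin k) (Fin k) ℂ)}
    (hT : T ⊆ S) : IsOrthogonalPosFamily W T where
  mem δ hδ := hS.mem δ (hT hδ)
  posSemidef δ hδ := hS.posSemidef δ (hT hδ)
  ne_zero δ hδ := hS.ne_zero δ (hT hδ)
  mul_eq_zero := hS.mul_eq_zero.mono (Finset.coe_subset.mpr hT)

theorem cons (hS : IsOrthogonalPosFamily W S) (hpW : p ∈ W) (hp : p.PosSemidef) (hp0 : p ≠ 0)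
    (hpS : ∀ δ ∈ S, p * δ = 0) :
    ∃ hpS' : p ∉ S, IsOrthogonalPosFamily W (S.cons p hpS') := by
  refine ⟨fun h => hp0 (eq_zero_of_mul_self_eq_zero hp.isHermitian (hpS p h)),
    (Finset.forall_mem_cons _ _).mpr ⟨hpW, hS.mem⟩,
    (Finset.forall_mem_cons _ _).mpr ⟨hp, hS.posSemidef⟩,
    (Finset.forall_mem_cons _ _).mpr ⟨hp0, hS.ne_zero⟩, ?_⟩
  rw [Finset.coe_cons, Set.pairwise_insert]
  exact ⟨hS.mul_eq_zero, fun δ hδ _ => ⟨hpS δ hδ, (mul_eq_zero_comm_of_isHermitian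
    hp.isHermitian (hS.posSemidef δ hδ).isHermitian).mp (hpS δ hδ)⟩⟩

theorem linearIndependent (hS : IsOrthogonalPosFamily W S) :
    LinearIndependent ℂ (fun δ : S => (δ : Matrix (Fin k) (Fin k) ℂ)) :=
  linearIndependent_of_ne_zero_of_inner_eq_zero (fun δ => hS.ne_zero δ δ.2) fun δ δ' hne =>
    (inner_eq_zero_iff_mul_eq_zero (hS.posSemidef δ δ.2) (hS.posSemidef δ' δ'.2)).mpr
      (hS.mul_eq_zero δ.2 δ'.2 (Subtype.coe_ne_coe.mpr hne))

theorem card_le_finrank (hS : IsOrthogonalPosFamily W S) : S.card ≤ Module.finrank ℂ W := by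
  rw [← finrank_span_finset_eq_card hS.linearIndependent]
  exact Submodule.finrank_mono (Submodule.span_le.mpr hS.mem)

theorem exists_forall_card_le (W : Submodule ℂ (Matrix (Fin k) (Fin k) ℂ)) :
    ∃ S, IsOrthogonalPosFamily W S ∧ ∀ T, IsOrthogonalPosFamily W T → T.card ≤ S.card := by
  have hempty : IsOrthogonalPosFamily W ∅ := ⟨by simp, by simp, by simp, by simp⟩
  obtain ⟨S, hS, hmin⟩ := WellFounded.has_min
    (measure fun S : Finset (Matrix (Fin k) (Fin k) ℂ) => Module.finrank ℂ W - S.card).wf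
    {S | IsOrthogonalPosFamily W S} ⟨∅, hempty⟩
  refine ⟨S, hS, fun T hT => ?_⟩
  have hle : Module.finrank ℂ W - S.card ≤ Module.finrank ℂ W - T.card := not_lt.mp (hmin T hT)
  have := hT.card_le_finrank
  have := hS.card_le_finrank
  omega

theorem eq_zero_of_forall_mul_eq_zero (hS : IsOrthogonalPosFamily W S)
    (hmax : ∀ T, IsOrthogonalPosFamily W T → T.card ≤ S.card) (hpW : p ∈ W) (hp : p.PosSemidef)
    (hpS : ∀ δ ∈ S, p * δ = 0) : p = 0 := by
  by_contra hp0
  obtain ⟨_, hcons⟩ := hS.cons hpW hp hp0 hpS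
  have := hmax _ hcons
  rw [Finset.card_cons] at this
  omega

theorem eq_zero_or_eq_zero_of_mul_eq_zero (hS : IsOrthogonalPosFamily W S)
    (hmax : ∀ T, IsOrthogonalPosFamily W T → T.card ≤ S.card) (hδ : δ ∈ S)
    (hpW : p ∈ W) (hp : p.PosSemidef) (hqW : q ∈ W) (hq : q.PosSemidef) (hpq : p * q = 0)
    (hpδ : p * hermProj (image δ) = p) (hqδ : q * hermProj (image δ) = q) : p = 0 ∨ q = 0 := by
  classical
  have mul_eq_zero_of_support {r δ' : Matrix (Fin k) (Fin k) ℂ}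
      (hr : r * hermProj (image δ) = r) (hδ' : δ' ∈ S.erase δ) : r * δ' = 0 := by
    have hδδ' := hS.mul_eq_zero hδ (Finset.mem_of_mem_erase hδ') (Finset.ne_of_mem_erase hδ').symm
    rw [← hr, Matrix.mul_assoc, hermProj_image_mul_eq_zero (hS.posSemidef δ hδ).isHermitian hδδ',
      Matrix.mul_zero]
  by_contra! hne
  obtain ⟨_, hq_cons⟩ := (hS.mono (S.erase_subset δ)).cons hqW hq hne.2
    fun δ' => mul_eq_zero_of_support hqδ
  obtain ⟨_, hpq_cons⟩ := hq_cons.cons hpW hp hne.1 <| Finset.forall_mem_cons _ _ |>.mpr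
    ⟨hpq, fun δ' => mul_eq_zero_of_support hpδ⟩
  have := hmax _ hpq_cons
  rw [Finset.card_cons, Finset.card_cons, Finset.card_erase_add_one hδ] at this
  omega

end IsOrthogonalPosFamily

theorem IsSupportClosed.exists_mem_posSemidef_sub (hW : IsSupportClosed W)
    {X : Matrix (Fin k) (Fin k) ℂ} (hX : X.IsHermitian) (hXW : X ∈ W) :
    ∃ p ∈ W, ∃ q ∈ W, p.PosSemidef ∧ q.PosSemidef ∧ p * q = 0 ∧ X = p - q ∧
      ∀ Z, X * Z = 0 → p * Z = 0 ∧ q * Z = 0 := by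
  obtain ⟨p, q, hp, hq, hpq, rfl⟩ := exists_posSemidef_sub_posSemidef hX
  have hqp := (mul_eq_zero_comm_of_isHermitian hp.isHermitian hq.isHermitian).mp hpq
  refine ⟨p, hW.posPart_mem hp hq hpq hXW, q, hW.posPart_mem hq hp hqp ?_, hp, hq, hpq, rfl,
    fun Z hZ => ⟨mul_eq_zero_of_sub_mul_eq_zero hp.isHermitian hpq hZ,
      mul_eq_zero_of_sub_mul_eq_zero hq.isHermitian hqp ?_⟩⟩
  · rw [← neg_sub]
    exact W.neg_mem hXW
  · rw [← neg_sub, Matrix.neg_mul, hZ, neg_zero]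

namespace IsSupportClosed

theorem eq_zero_of_forall_mul_eq_zero (hW : IsSupportClosed W) (hS : IsOrthogonalPosFamily W S)
    (hmax : ∀ T, IsOrthogonalPosFamily W T → T.card ≤ S.card) {X : Matrix (Fin k) (Fin k) ℂ}
    (hX : X.IsHermitian) (hXW : X ∈ W) (hXS : ∀ δ ∈ S, X * δ = 0) : X = 0 := by
  obtain ⟨p, hpW, q, hqW, hp, hq, -, rfl, hZ⟩ := hW.exists_mem_posSemidef_sub hX hXW
  rw [hS.eq_zero_of_forall_mul_eq_zero hmax hpW hp fun δ hδ => (hZ δ (hXS δ hδ)).1,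
    hS.eq_zero_of_forall_mul_eq_zero hmax hqW hq fun δ hδ => (hZ δ (hXS δ hδ)).2, sub_zero]

theorem eq_zero_of_inner_eq_zero (hW : IsSupportClosed W) (hS : IsOrthogonalPosFamily W S)
    (hmax : ∀ T, IsOrthogonalPosFamily W T → T.card ≤ S.card) (hδ : δ ∈ S)
    {X : Matrix (Fin k) (Fin k) ℂ} (hX : X.IsHermitian) (hXW : X ∈ W)
    (hXδ : X * hermProj (image δ) = X) (horth : ⟪δ, X⟫_ℂ = 0) : X = 0 := by
  have hδ_pos := hS.posSemidef δ hδ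
  obtain ⟨p, hpW, q, hqW, hp, hq, hpq, rfl, hZ⟩ := hW.exists_mem_posSemidef_sub hX hXW
  obtain ⟨hpδ, hqδ⟩ := hZ (1 - hermProj (image δ)) (by rw [Matrix.mul_sub, hXδ]; simp)
  rw [Matrix.mul_sub, Matrix.mul_one, sub_eq_zero, eq_comm] at hpδ hqδ
  have eq_zero_of_support {r : Matrix (Fin k) (Fin k) ℂ} (hr : r.PosSemidef)
      (hrδ : r * hermProj (image δ) = r) (h : ⟪δ, r⟫_ℂ = 0) : r = 0 := by
    rw [inner_eq_zero_iff_mul_eq_zero hδ_pos hr] at h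
    have hmul := hermProj_image_mul_eq_zero hδ_pos.isHermitian h
    rwa [mul_eq_zero_comm_of_isHermitian (isHermitian_hermProj _) hr.isHermitian, hrδ] at hmul
  rw [inner_sub_right] at horth
  rcases hS.eq_zero_or_eq_zero_of_mul_eq_zero hmax hδ hpW hp hqW hq hpq hpδ hqδ with rfl | rfl
  · rw [eq_zero_of_support hq hqδ (by simpa using horth), sub_zero]
  · rw [eq_zero_of_support hp hpδ (by simpa using horth), sub_zero]

theorem hermProj_mul_mem_span (hW : IsSupportClosed W) (hS : IsOrthogonalPosFamily W S)
    (hmax : ∀ T, IsOrthogonalPosFamily W T → T.card ≤ S.card) (hδ : δ ∈ S)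
    {X : Matrix (Fin k) (Fin k) ℂ} (hX : X.IsHermitian) (hXW : X ∈ W) :
    hermProj (image δ) * X ∈ Submodule.span ℂ (S : Set (Matrix (Fin k) (Fin k) ℂ)) := by
  have hδ_pos := hS.posSemidef δ hδ
  have hδW := hS.mem δ hδ
  have hcomm := hW.hermProj_mul_comm hδ_pos hδW hXW
  set V := hermProj (image δ)
  have hVX : (V * X).IsHermitian := by
    rw [IsHermitian, conjTranspose_mul, (isHermitian_hermProj _).eq, hX.eq, hcomm]
  let c : ℂ := ⟪δ, V * X⟫_ℂ / ⟪δ, δ⟫_ℂ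
  have hc : star c = c := by
    rw [RCLike.star_def, map_div₀, inner_self_conj,
      ← re_inner_of_isHermitian hδ_pos.isHermitian hVX, Complex.conj_ofReal,
      re_inner_of_isHermitian hδ_pos.isHermitian hVX]
  have hcδ : c * ⟪δ, δ⟫_ℂ = ⟪δ, V * X⟫_ℂ :=
    div_mul_cancel₀ _ (inner_self_ne_zero.mpr (hS.ne_zero δ hδ))
  have hzero : V * X - c • δ = 0 := by
    refine hW.eq_zero_of_inner_eq_zero hS hmax hδ (hVX.sub ?_)
      (W.sub_mem (hW.hermProj_mul_mem hδ_pos hδW hXW) (W.smul_mem _ hδW)) ?_ ?_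
    · rw [IsHermitian, conjTranspose_smul, hδ_pos.isHermitian.eq, hc]
    · rw [Matrix.sub_mul, smul_mul, mul_hermProj_image hδ_pos.isHermitian, Matrix.mul_assoc,
        ← hcomm, ← Matrix.mul_assoc, hermProj_mul_self]
    · rw [inner_sub_right, inner_smul_right, hcδ, sub_self]
  rw [sub_eq_zero.mp hzero]
  exact Submodule.smul_mem _ _ (Submodule.subset_span hδ)

theorem eq_sum_hermProj_mul (hW : IsSupportClosed W) (hS : IsOrthogonalPosFamily W S)
    (hmax : ∀ T, IsOrthogonalPosFamily W T → T.card ≤ S.card)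
    {X : Matrix (Fin k) (Fin k) ℂ} (hX : X.IsHermitian) (hXW : X ∈ W) :
    X = ∑ δ ∈ S, hermProj (image δ) * X := by
  have hcomm (δ) (hδ : δ ∈ S) := hW.hermProj_mul_comm (hS.posSemidef δ hδ) (hS.mem δ hδ) hXW
  refine sub_eq_zero.mp (hW.eq_zero_of_forall_mul_eq_zero hS hmax ?_ ?_ fun δ' hδ' => ?_)
  · rw [IsHermitian, conjTranspose_sub, conjTranspose_sum, hX.eq]
    refine congrArg _ (Finset.sum_congr rfl fun δ hδ => ?_)
    rw [conjTranspose_mul, (isHermitian_hermProj _).eq, hX.eq, hcomm δ hδ]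
  · exact W.sub_mem hXW (W.sum_mem fun δ hδ =>
      hW.hermProj_mul_mem (hS.posSemidef δ hδ) (hS.mem δ hδ) hXW)
  · rw [Matrix.sub_mul, Finset.sum_mul, Finset.sum_eq_single_of_mem δ' hδ', hcomm δ' hδ',
      Matrix.mul_assoc, hermProj_image_mul, sub_self]
    intro δ hδ hne
    rw [hcomm δ hδ, Matrix.mul_assoc, hermProj_image_mul_eq_zero (hS.posSemidef δ hδ).isHermitian
      (hS.mul_eq_zero hδ hδ' hne), Matrix.mul_zero]

theorem span_eq (hW : IsSupportClosed W) (hS : IsOrthogonalPosFamily W S)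
    (hmax : ∀ T, IsOrthogonalPosFamily W T → T.card ≤ S.card) :
    Submodule.span ℂ (S : Set (Matrix (Fin k) (Fin k) ℂ)) = W := by
  refine le_antisymm (Submodule.span_le.mpr hS.mem)
    (hW.le_span_isHermitian.trans (Submodule.span_le.mpr ?_))
  rintro X ⟨hXW, hX⟩
  rw [hW.eq_sum_hermProj_mul hS hmax hX hXW]
  exact Submodule.sum_mem _ fun δ hδ => hW.hermProj_mul_mem_span hS hmax hδ hX hXW

theorem exists_orthonormal_posSemidef (hW : IsSupportClosed W) :
    ∃ f : Fin (Module.finrank ℂ W) → Matrix (Fin k) (Fin k) ℂ, Orthonormal ℂ f ∧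
      (∀ i, (f i).PosSemidef) ∧ Submodule.span ℂ (Set.range f) = W := by
  obtain ⟨S, hS, hmax⟩ := IsOrthogonalPosFamily.exists_forall_card_le W
  have hcard : S.card = Module.finrank ℂ W := by
    rw [← finrank_span_finset_eq_card hS.linearIndependent, hW.span_eq hS hmax]
  let e := S.equivFinOfCardEq hcard
  let f (i : Fin (Module.finrank ℂ W)) : Matrix (Fin k) (Fin k) ℂ :=
    (‖(e.symm i).1‖⁻¹ : ℂ) • (e.symm i).1
  have hf : Orthonormal ℂ f := by
    refine ⟨fun i => norm_smul_inv_norm (hS.ne_zero _ (e.symm i).2), fun i j hij => ?_⟩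
    simp only [f]
    rw [inner_smul_left, inner_smul_right, (inner_eq_zero_iff_mul_eq_zero
      (hS.posSemidef _ (e.symm i).2) (hS.posSemidef _ (e.symm j).2)).mpr
      (hS.mul_eq_zero (e.symm i).2 (e.symm j).2
        (Subtype.coe_ne_coe.mpr (e.symm.injective.ne hij))), mul_zero, mul_zero]
  refine ⟨f, hf, fun i => (hS.posSemidef _ (e.symm i).2).smul ?_,
    Submodule.eq_of_le_of_finrank_eq (Submodule.span_le.mpr ?_) ?_⟩
  · rw [← Complex.ofReal_inv]
    exact_mod_cast inv_nonneg.mpr (norm_nonneg _)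
  · rintro _ ⟨i, rfl⟩
    exact W.smul_mem _ (hS.mem _ (e.symm i).2)
  · rw [finrank_span_eq_card hf.linearIndependent, Fintype.card_fin]

end IsSupportClosed

end SupportClosed

section PosSchmidt

variable {k s : ℕ} {m : Type*} [Fintype m] [DecidableEq m]

theorem contract_sum_kronecker_self {ι : Type*} [Fintype ι] {f : ι → Matrix m m ℂ}
    (hf : ∀ i, (f i).IsHermitian) (X : Matrix m m ℂ) :
    contract (∑ i, f i ⊗ₖ f i) X = ∑ i, ⟪f i, X⟫_ℂ • f i := by
  simpa only [one_smul, one_mul] using contract_sum_smul_kronecker (fun _ => 1) hf f X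

theorem sum_kronecker_self_eq_iff {ι κ : Type*} [Fintype ι] [Fintype κ]
    {f : ι → Matrix m m ℂ} {g : κ → Matrix m m ℂ}
    (hf : Orthonormal ℂ f) (hfH : ∀ i, (f i).IsHermitian)
    (hg : Orthonormal ℂ g) (hgH : ∀ i, (g i).IsHermitian) :
    ∑ i, f i ⊗ₖ f i = ∑ i, g i ⊗ₖ g i ↔
      Submodule.span ℂ (Set.range f) = Submodule.span ℂ (Set.range g) := by
  constructor
  · intro h
    ext X
    rw [← sum_inner_smul_eq_self_iff hf, ← sum_inner_smul_eq_self_iff hg,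
      ← contract_sum_kronecker_self hfH, ← contract_sum_kronecker_self hgH, h]
  · intro h
    refine contract_injective (LinearMap.ext fun X => ?_)
    rw [contract_sum_kronecker_self hfH, contract_sum_kronecker_self hgH,
      sum_inner_smul_eq_starProjection hf h, sum_inner_smul_eq_starProjection hg rfl]

namespace IsPosSchmidtDecomposition

variable {D : Matrix (Fin k × Fin k) (Fin k × Fin k) ℂ} {f g : Fin s → Matrix (Fin k) (Fin k) ℂ}

theorem eq_sum_kronecker_self (hf : IsPosSchmidtDecomposition D f) : D = ∑ i, f i ⊗ₖ f i := by
  simpa only [Complex.ofReal_one, one_smul] using hf.1.eq_sum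

theorem exists_perm_eq (hf : IsPosSchmidtDecomposition D f) (hg : IsPosSchmidtDecomposition D g) :
    ∃ σ : Equiv.Perm (Fin s), ∀ i, g i = f (σ i) := by
  refine exists_perm_eq_of_inner_nonneg hf.1.orthonormal hg.1.orthonormal ?_
    fun i j => inner_nonneg_of_posSemidef (hf.2 j) (hg.2 i)
  rw [← sum_kronecker_self_eq_iff hf.1.orthonormal hf.1.isHermitian_left hg.1.orthonormal
    hg.1.isHermitian_left, ← hf.eq_sum_kronecker_self, ← hg.eq_sum_kronecker_self]

theorem orthogonalFamily_image (hf : IsPosSchmidtDecomposition D f) :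
    OrthogonalFamily ℂ (fun i => image (f i)) fun i => (image (f i)).subtypeₗᵢ :=
  OrthogonalFamily.of_pairwise fun i j hij =>
    isOrtho_image_of_mul_eq_zero (hf.2 i).isHermitian
      ((inner_eq_zero_iff_mul_eq_zero (hf.2 i) (hf.2 j)).mp (hf.1.orthonormal.2 hij))

end IsPosSchmidtDecomposition

theorem isPosSchmidtDecomposition_of_orthonormal {f : Fin s → Matrix (Fin k) (Fin k) ℂ}
    (hf : Orthonormal ℂ f) (hpos : ∀ i, (f i).PosSemidef) :
    IsPosSchmidtDecomposition (∑ i, f i ⊗ₖ f i) f where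
  left :=
    { pos := fun _ => one_pos
      orthonormal_left := traceOrthonormal_iff_orthonormal.mpr hf
      orthonormal_right := traceOrthonormal_iff_orthonormal.mpr hf
      eq_sum := by simp only [Complex.ofReal_one, one_smul]
      isHermitian_left := fun i => (hpos i).isHermitian
      isHermitian_right := fun i => (hpos i).isHermitian }
  right := hpos

theorem splitProj_mem_splittingSubmodule {A : Matrix (Fin k × Fin k) (Fin k × Fin k) ℂ}
    {f : Fin s → Matrix (Fin k) (Fin k) ℂ}
    (hf : OrthogonalFamily ℂ (fun i => image (f i)) fun i => (image (f i)).subtypeₗᵢ)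
    (hA : ∀ i, hermProj (image (f i)) ∈ splittingSubmodule A) (i : Fin (s + 1)) :
    splitProj f i ∈ splittingSubmodule A := by
  refine forall_splitProj (P := (· ∈ splittingSubmodule A)) hA ?_ i
  rw [hermProj_orthogonal, hermProj_iSup hf]
  exact Submodule.sub_mem _ one_mem_splittingSubmodule (Submodule.sum_mem _ fun i _ => hA i)

end PosSchmidt

section Compression

variable {k : ℕ}

theorem sum_orthogonal_kronecker_self {ι m : Type*} [Fintype ι] [DecidableEq ι]
    {U : Matrix ι ι ℝ} (hU : U ∈ orthogonalGroup ι ℝ) (P : ι → Matrix m m ℂ) :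
    ∑ i, (∑ l, (U l i : ℂ) • P l) ⊗ₖ (∑ l, (U l i : ℂ) • P l) = ∑ l, P l ⊗ₖ P l := by
  have hUU (l l' : ι) : ∑ i, (U l i : ℂ) * U l' i = if l = l' then 1 else 0 := by
    have := congrFun₂ (mem_unitaryGroup_iff.mp hU) l l'
    simp only [mul_apply, star_apply, star_trivial, one_apply] at this
    simpa [apply_ite Complex.ofReal] using congrArg Complex.ofReal this
  ext ⟨a, b⟩ ⟨c, d⟩
  simp only [Matrix.sum_apply, kronecker_apply, Matrix.smul_apply, smul_eq_mul, Finset.sum_mul_sum]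
  calc ∑ i, ∑ l, ∑ l', U l i * P l a c * (U l' i * P l' b d)
      = ∑ l, ∑ l', (∑ i, (U l i : ℂ) * U l' i) * (P l a c * P l' b d) := by
        rw [Finset.sum_comm]
        refine Finset.sum_congr rfl fun l _ => ?_
        rw [Finset.sum_comm]
        refine Finset.sum_congr rfl fun l' _ => ?_
        rw [Finset.sum_mul]
        exact Finset.sum_congr rfl fun i _ => by ring
    _ = ∑ l, P l a c * P l b d := by simp [hUU]

theorem isHermitian_ofReal_smul {m : Type*} {M : Matrix m m ℂ} (hM : M.IsHermitian) (c : ℝ) :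
    ((c : ℂ) • M).IsHermitian := by
  rw [IsHermitian, conjTranspose_smul, RCLike.star_def, Complex.conj_ofReal, hM.eq]

theorem exists_isHermitianSchmidtDecomposition_of_pairwise_inner_eq_zero {ι : Type*} [Fintype ι]
    {ξ : ι → Matrix (Fin k) (Fin k) ℂ} (hξ : ∀ i, (ξ i).IsHermitian)
    (horth : Pairwise fun i j => ⟪ξ i, ξ j⟫_ℂ = 0) :
    ∃ (n : ℕ) (lam : Fin n → ℝ) (γ : Fin n → Matrix (Fin k) (Fin k) ℂ),
      IsHermitianSchmidtDecomposition (∑ i, ξ i ⊗ₖ ξ i) lam γ γ := by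
  classical
  let e := (Fintype.equivFin {i // ξ i ≠ 0}).symm
  let γ (i : Fin _) : Matrix (Fin k) (Fin k) ℂ := ((‖ξ (e i)‖⁻¹ : ℝ) : ℂ) • ξ (e i)
  have hγ (i) : (γ i).IsHermitian := isHermitian_ofReal_smul (hξ _) _
  have hortho : Orthonormal ℂ γ := by
    refine ⟨fun i => ?_, fun i j hij => ?_⟩
    · rw [norm_smul, Complex.norm_real, norm_inv, norm_norm,
        inv_mul_cancel₀ (norm_ne_zero_iff.mpr (e i).2)]
    · simp only [γ]
      rw [inner_smul_left, inner_smul_right, horth (Subtype.coe_ne_coe.mpr (e.injective.ne hij)),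
        mul_zero, mul_zero]
  refine ⟨_, fun i => ‖ξ (e i)‖ ^ 2, γ, ⟨⟨fun i => pow_pos (norm_pos_iff.mpr (e i).2) 2,
    traceOrthonormal_iff_orthonormal.mpr hortho, traceOrthonormal_iff_orthonormal.mpr hortho, ?_⟩,
    hγ, hγ⟩⟩
  have hterm (i) : ((‖ξ (e i)‖ ^ 2 : ℝ) : ℂ) • (γ i ⊗ₖ γ i) = ξ (e i) ⊗ₖ ξ (e i) := by
    have hnorm : ‖ξ (e i)‖ ≠ 0 := norm_ne_zero_iff.mpr (e i).2
    simp only [γ, smul_kronecker, kronecker_smul, smul_smul, ← Complex.ofReal_mul]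
    rw [← mul_inv, ← sq, mul_inv_cancel₀ (pow_ne_zero 2 hnorm), Complex.ofReal_one, one_smul]
  calc ∑ i, ξ i ⊗ₖ ξ i = ∑ i with ξ i ≠ 0, ξ i ⊗ₖ ξ i := by
        refine (Finset.sum_filter_of_ne (p := fun i => ξ i ≠ 0) fun i _ hi h0 => hi ?_).symm
        rw [h0, zero_kronecker]
    _ = ∑ i : {i // ξ i ≠ 0}, ξ i ⊗ₖ ξ i := Finset.sum_subtype _ (by simp) fun i => ξ i ⊗ₖ ξ i
    _ = ∑ i, ((‖ξ (e i)‖ ^ 2 : ℝ) : ℂ) • (γ i ⊗ₖ γ i) := by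
        simp only [hterm]
        exact (e.sum_comp fun i => ξ i ⊗ₖ ξ i).symm

-- Diagonalising the real Gram matrix of the `ζ i` makes them orthogonal without changing the sum.
theorem isSPC_sum_kronecker_self {ι : Type*} [Fintype ι] {ζ : ι → Matrix (Fin k) (Fin k) ℂ}
    (hζ : ∀ i, (ζ i).IsHermitian) (hpos : (∑ i, ζ i ⊗ₖ ζ i).PosSemidef) :
    IsSPC (∑ i, ζ i ⊗ₖ ζ i) := by
  classical
  obtain ⟨U, hU, horth⟩ := exists_orthogonalGroup_pairwise_inner_eq_zero (𝕜 := ℂ) (v := ζ)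
    fun i j => re_inner_of_isHermitian (hζ i) (hζ j)
  refine ⟨hpos, ?_⟩
  rw [← sum_orthogonal_kronecker_self hU ζ]
  refine exists_isHermitianSchmidtDecomposition_of_pairwise_inner_eq_zero (fun i => ?_) horth
  rw [IsHermitian, conjTranspose_sum]
  exact Finset.sum_congr rfl fun l _ => isHermitian_ofReal_smul (hζ l) _

theorem IsSPC.kronecker_self_mul_mul_conjTranspose
    {A : Matrix (Fin k × Fin k) (Fin k × Fin k) ℂ} (hA : IsSPC A) (M : Matrix (Fin k) (Fin k) ℂ) :
    IsSPC ((M ⊗ₖ M) * A * (M ⊗ₖ M)ᴴ) := by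
  obtain ⟨hpos, n, lam, γ, h⟩ := hA
  have hsum : (M ⊗ₖ M) * A * (M ⊗ₖ M)ᴴ =
      ∑ i, ((√(lam i) : ℂ) • (M * γ i * Mᴴ)) ⊗ₖ ((√(lam i) : ℂ) • (M * γ i * Mᴴ)) := by
    conv_lhs => rw [h.eq_sum, Matrix.mul_sum, Matrix.sum_mul]
    refine Finset.sum_congr rfl fun i _ => ?_
    rw [Matrix.mul_smul, smul_mul, conjTranspose_kronecker, ← mul_kronecker_mul,
      ← mul_kronecker_mul, smul_kronecker, kronecker_smul, smul_smul, ← Complex.ofReal_mul,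
      Real.mul_self_sqrt (h.pos i).le]
  have hposM := hpos.mul_mul_conjTranspose_same (M ⊗ₖ M)
  rw [hsum] at hposM ⊢
  exact isSPC_sum_kronecker_self (fun i => isHermitian_ofReal_smul
    (isHermitian_mul_mul_conjTranspose M (h.isHermitian_left i)) _) hposM

end Compression

section TopEigenspace

variable {k n s : ℕ} {A : Matrix (Fin k × Fin k) (Fin k × Fin k) ℂ} {lam : Fin n → ℝ}
  {γ : Fin n → Matrix (Fin k) (Fin k) ℂ} {L : ℝ} {e : Fin s → Fin n}

namespace IsHermitianSchmidtDecomposition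

theorem eigenspace_contract_eq_span_range (h : IsHermitianSchmidtDecomposition A lam γ γ)
    (hL : L ≠ 0) (he : {i | lam i = L} = Set.range e) :
    Module.End.eigenspace (contract A) (L : ℂ) = Submodule.span ℂ (Set.range (γ ∘ e)) := by
  rw [h.eigenspace_contract hL, he, Set.range_comp]

theorem exists_isPosSchmidtDecomposition (h : IsHermitianSchmidtDecomposition A lam γ γ)
    (hA : A.PosSemidef) (hL : 0 < L) (hlam : ∀ i, lam i ≤ L) (he : Function.Injective e)
    (hrange : {i | lam i = L} = Set.range e) :
    ∃ f : Fin s → Matrix (Fin k) (Fin k) ℂ,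
      IsPosSchmidtDecomposition (∑ i, γ (e i) ⊗ₖ γ (e i)) f := by
  have hγ := h.orthonormal.comp e he
  have hspan := h.eigenspace_contract_eq_span_range hL.ne' hrange
  obtain rfl : Module.finrank ℂ (Module.End.eigenspace (contract A) (L : ℂ)) = s := by
    rw [hspan, finrank_span_eq_card hγ.linearIndependent, Fintype.card_fin]
  obtain ⟨f, hf, hpos, hf_span⟩ :=
    (h.isSupportClosed_eigenspace hA hL hlam).exists_orthonormal_posSemidef
  have hsum : ∑ i, γ (e i) ⊗ₖ γ (e i) = ∑ i, f i ⊗ₖ f i :=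
    (sum_kronecker_self_eq_iff hγ (fun i => h.isHermitian_left (e i)) hf
      fun i => (hpos i).isHermitian).mpr (hspan.symm.trans hf_span.symm)
  exact ⟨f, hsum ▸ isPosSchmidtDecomposition_of_orthonormal hf hpos⟩

theorem hermProj_image_mem_splittingSubmodule_of_isPosSchmidtDecomposition
    (h : IsHermitianSchmidtDecomposition A lam γ γ) (hA : A.PosSemidef) (hL : L ≠ 0)
    (he : Function.Injective e) (hrange : {i | lam i = L} = Set.range e)
    {f : Fin s → Matrix (Fin k) (Fin k) ℂ}
    (hf : IsPosSchmidtDecomposition (∑ i, γ (e i) ⊗ₖ γ (e i)) f) (i : Fin s) :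
    hermProj (image (f i)) ∈ splittingSubmodule A := by
  have hspan : Submodule.span ℂ (Set.range f) = Submodule.span ℂ (Set.range (γ ∘ e)) :=
    (sum_kronecker_self_eq_iff hf.1.orthonormal hf.1.isHermitian_left (h.orthonormal.comp e he)
      fun i => h.isHermitian_left (e i)).mp hf.eq_sum_kronecker_self.symm
  refine h.hermProj_image_mem_splittingSubmodule hA (hf.2 i) (μ := (L : ℂ)) ?_
  rw [h.eigenspace_contract_eq_span_range hL hrange, ← hspan]
  exact Submodule.subset_span (Set.mem_range_self i)

end IsHermitianSchmidtDecomposition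

theorem setOf_eq_eq_range_castLE {α : Type*} [Preorder α] {lam : Fin n → α} (hsn : s ≤ n)
    (heq : ∀ i j : Fin n, (i : ℕ) < s → (j : ℕ) < s → lam i = lam j)
    (hgt : ∀ i j : Fin n, (i : ℕ) < s → s ≤ (j : ℕ) → lam j < lam i) {i : Fin n}
    (hi : (i : ℕ) < s) : {j | lam j = lam i} = Set.range (Fin.castLE hsn) := by
  rw [Fin.range_castLE]
  ext j
  exact ⟨fun hj => not_le.mp fun hsj => (hgt i j hi hsj).ne hj, fun hj => heq j i hj hi⟩

end TopEigenspace

end SplitDecomposition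

open SplitDecomposition in
theorem mainTheorem3 (k n s : ℕ) (hs : 1 ≤ s) (hsn : s ≤ n)
    (A : Matrix (Fin k × Fin k) (Fin k × Fin k) ℂ) (hA : IsSPC A)
    (lam : Fin n → ℝ) (γ : Fin n → Matrix (Fin k) (Fin k) ℂ)
    (hdec : IsHermitianSchmidtDecomposition A lam γ γ)
    (hanti : Antitone lam)
    (heq : ∀ i j : Fin n, (i : ℕ) < s → (j : ℕ) < s → lam i = lam j)
    (hgt : ∀ i j : Fin n, (i : ℕ) < s → s ≤ (j : ℕ) → lam j < lam i)
    (D : Matrix (Fin k × Fin k) (Fin k × Fin k) ℂ)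
    (hD : D = ∑ i : Fin s, γ (Fin.castLE hsn i) ⊗ₖ γ (Fin.castLE hsn i)) :
    (∃ γ' : Fin s → Matrix (Fin k) (Fin k) ℂ, IsPosSchmidtDecomposition D γ' ∧
      ∀ γ'' : Fin s → Matrix (Fin k) (Fin k) ℂ, IsPosSchmidtDecomposition D γ'' →
        ∃ σ : Equiv.Perm (Fin s), ∀ i, γ'' i = γ' (σ i)) ∧
    ∀ γ' : Fin s → Matrix (Fin k) (Fin k) ℂ, IsPosSchmidtDecomposition D γ' →
      iSupIndep (fun i => image (γ' i)) ∧
      A = ∑ i : Fin (s + 1),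
        (splitProj γ' i ⊗ₖ splitProj γ' i) * A * (splitProj γ' i ⊗ₖ splitProj γ' i) ∧
      ∀ i : Fin (s + 1),
        IsSPC ((splitProj γ' i ⊗ₖ splitProj γ' i) * A * (splitProj γ' i ⊗ₖ splitProj γ' i)) := by
  let top : Fin n := ⟨0, hs.trans hsn⟩
  have htop : {i | lam i = lam top} = Set.range (Fin.castLE hsn) :=
    setOf_eq_eq_range_castLE hsn heq hgt hs
  have hle (i : Fin n) : lam i ≤ lam top := hanti (Nat.zero_le i)
  subst hD
  refine ⟨?_, fun f hf => ?_⟩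
  · obtain ⟨f, hf⟩ := hdec.exists_isPosSchmidtDecomposition hA.1 (hdec.pos top) hle
      (Fin.castLE_injective hsn) htop
    exact ⟨f, hf, fun g hg => hf.exists_perm_eq hg⟩
  · have hortho := hf.orthogonalFamily_image
    have hsplit := splitProj_mem_splittingSubmodule hortho
      (hdec.hermProj_image_mem_splittingSubmodule_of_isPosSchmidtDecomposition hA.1
        (hdec.pos top).ne' (Fin.castLE_injective hsn) htop hf)
    refine ⟨hortho.independent, eq_sum_kronecker_self_mul_mul_kronecker_self hsplit
      (splitProj_mul_self f) (sum_splitProj hortho), fun i => ?_⟩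
    simpa only [Matrix.conjTranspose_kronecker, (isHermitian_splitProj f i).eq] using
      hA.kronecker_self_mul_mul_conjTranspose (splitProj f i)
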